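/- Let $X$ be a topological space. For $A\subseteq X$ and an open cover $\mathcal U$ of $X$ put $\mathrm{st}^1(A,\mathcal U)=\bigcup\{U\in\mathcal U: U\cap A\neq\emptyset\}$ and $\mathrm{st}^{k+1}(A,\mathcal U)=\mathrm{st}^1(\mathrm{st}^k(A,\mathcal U),\mathcal U)$. For an integer $k\ge 1$, the space $X$ is - $k$-SL ($k$-star-Lindelöf; SL for $k=1$) if every open cover $\mathcal U$ of $X$ has a countable subfamily $\mathcal U'\subseteq\mathcal U$ with $\mathrm{st}^k(\bigcup\mathcal U',\mathcal U)=X$; - weakly SSL (weakly strongly star-Lindelöf) if for every open cover $\mathcal U$ of $X$ there is a countable set $A\subseteq X$ with $\overline{\mathrm{st}^1(A,\mathcal U)}=X$; - selectively $k$-star-ccc (selectively star-ccc for $k=1$) if for every open cover $\mathcal U$ of $X$ and every sequence $(\mathcal A_n)_{n\in\omega}$ of maximal pairwise disjoint families of nonempty open subsets of $X$ there are $A_n\in\mathcal A_n$ $(n\in\omega)$ with $\mathrm{st}^k(\bigcup_{n\in\omega}A_n,\mathcal U)=X$. The space $X$ has the DCCC if it has no uncountable discrete family of open sets, where a family is discrete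 if every point of $X$ has a neighbourhood meeting at most one of its members. Then: 1. There exists a nonempty Hausdorff first-countable space that is SL (hence selectively $2$-star-ccc) but not selectively star-ccc. 2. There exists a nonempty Hausdorff first-countable space that is $2$-SL (hence selectively $3$-star-ccc) but is neither selectively $2$-star-ccc nor weakly SSL, and does not have the DCCC. -/

import Mathlib

namespace StarCov

open Topology

variable {X : Type*}

/-- The star of `A` with respect to `𝒰`: the union of all members of `𝒰` meeting `A`. -/
def star (A : Set X) (𝒰 : Set (Set X)) : Set X :=
  ⋃₀ {U | U ∈ 𝒰 ∧ (U ∩ A).Nonempty}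

/-- The iterated star `st^k(A, 𝒰)`; it is used for `k ≥ 1`, with the convention
`st^0(A, 𝒰) = A`, so that `st^1(A, 𝒰)` is the star of `A`. -/
def iterStar : ℕ → Set X → Set (Set X) → Set X
  | 0, A, _ => A
  | k + 1, A, 𝒰 => star (iterStar k A 𝒰) 𝒰

variable (X) [TopologicalSpace X]

/-- `𝒰` is an open cover of `X`. -/
def IsOpenCover (𝒰 : Set (Set X)) : Prop :=
  (∀ U ∈ 𝒰, IsOpen U) ∧ ⋃₀ 𝒰 = Set.univ

/-- `𝒜` is a pairwise disjoint family of nonempty open subsets of `X`. -/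
def IsDisjointOpenFamily (𝒜 : Set (Set X)) : Prop :=
  (∀ A ∈ 𝒜, IsOpen A ∧ A.Nonempty) ∧ 𝒜.Pairwise Disjoint

/-- `𝒜` is a pairwise disjoint family of nonempty open sets that is maximal under inclusion. -/
def IsMaximalDisjointOpenFamily (𝒜 : Set (Set X)) : Prop :=
  Maximal (IsDisjointOpenFamily X) 𝒜

/-- `X` is `k`-star-Lindelöf (`k`-SL). -/
def IsSL (k : ℕ) : Prop :=
  ∀ 𝒰 : Set (Set X), IsOpenCover X 𝒰 →
    ∃ 𝒰' ⊆ 𝒰, 𝒰'.Countable ∧ iterStar k (⋃₀ 𝒰') 𝒰 = Set.univ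

/-- `X` is weakly strongly `k`-star-Lindelöf (weakly `k`-SSL). -/
def IsWeaklySSL (k : ℕ) : Prop :=
  ∀ 𝒰 : Set (Set X), IsOpenCover X 𝒰 →
    ∃ A : Set X, A.Countable ∧ closure (iterStar k A 𝒰) = Set.univ

/-- `X` is selectively `k`-star-ccc. -/
def IsSelectivelyStarCCC (k : ℕ) : Prop :=
  ∀ 𝒰 : Set (Set X), IsOpenCover X 𝒰 →
    ∀ 𝒜 : ℕ → Set (Set X), (∀ n, IsMaximalDisjointOpenFamily X (𝒜 n)) →
      ∃ A : ℕ → Set X, (∀ n, A n ∈ 𝒜 n) ∧ iterStar k (⋃ n, A n) 𝒰 = Set.univ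

/-- `𝒟` is a discrete family: every point has a neighbourhood meeting at most one member. -/
def IsDiscreteFamily (𝒟 : Set (Set X)) : Prop :=
  ∀ x : X, ∃ N ∈ 𝓝 x, {D | D ∈ 𝒟 ∧ (D ∩ N).Nonempty}.Subsingleton

/-- The discrete countable chain condition: there is no uncountable discrete family of
open sets. -/
def DCCC : Prop :=
  ¬ ∃ 𝒟 : Set (Set X), (∀ D ∈ 𝒟, IsOpen D) ∧ IsDiscreteFamily X 𝒟 ∧ ¬ 𝒟.Countable

end StarCov

/-! For 1, take the Alexandroff duplicate of `[0,1]` times `ℝ` and delete the non-isolated points at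
height `0`. The points off height `0` form a dense σ-compact set, so the space is SL. Cover it by
that set and the vertical lines over isolated points. The lines minus height `0` form a maximal
disjoint family; countably many of them miss some line, whose point at height `0` lies in no other
member of the cover (`not_isSelectivelyStarCCC_one`).

For 2, glue uncountably many copies of a Hausdorff space `O` at a point `o`. If closures of nonempty
open sets of `O` always meet, any point is two stars away from a cover member containing the common
point (`isSL_two`). Conversely, separate `o` from some `z` by disjoint open sets `B` and `N`: by
`coord_mem_of_mem_star`, the star of a set missing a spine stays over `B` on that spine, which
refutes weak SSL and, with one more star, selective 2-star-ccc. The traces of `N` on the spines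
refute the DCCC. The space `O` is the positive integers with the relatively prime topology. -/

open Set Filter Topology

namespace StarCov

/-! ### Stars, maximal disjoint families and general implications -/

section General

variable {X : Type*}

theorem mem_star_iff {A : Set X} {𝒰 : Set (Set X)} {x : X} :
    x ∈ star A 𝒰 ↔ ∃ U ∈ 𝒰, (U ∩ A).Nonempty ∧ x ∈ U := by
  simp only [star, mem_sUnion, mem_ofPred_eq, and_assoc]

theorem star_mono {A B : Set X} (h : A ⊆ B) (𝒰 : Set (Set X)) : star A 𝒰 ⊆ star B 𝒰 := by
  intro x hx
  obtain ⟨U, hU, hne, hxU⟩ := mem_star_iff.1 hx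
  exact mem_star_iff.2 ⟨U, hU, hne.mono (inter_subset_inter_right U h), hxU⟩

theorem iterStar_mono (k : ℕ) {A B : Set X} (h : A ⊆ B) (𝒰 : Set (Set X)) :
    iterStar k A 𝒰 ⊆ iterStar k B 𝒰 := by
  induction k with
  | zero => exact h
  | succ k ih => exact star_mono ih 𝒰

theorem iterStar_one (A : Set X) (𝒰 : Set (Set X)) : iterStar 1 A 𝒰 = star A 𝒰 := rfl

theorem iterStar_succ_eq (k : ℕ) (A : Set X) (𝒰 : Set (Set X)) :
    iterStar (k + 1) A 𝒰 = iterStar k (star A 𝒰) 𝒰 := by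
  induction k with
  | zero => rfl
  | succ k ih =>
    change star (iterStar (k + 1) A 𝒰) 𝒰 = star (iterStar k (star A 𝒰) 𝒰) 𝒰
    rw [ih]

variable [TopologicalSpace X]

theorem IsOpenCover.exists_mem {𝒰 : Set (Set X)} (h : IsOpenCover X 𝒰) (x : X) :
    ∃ U ∈ 𝒰, x ∈ U := by
  have hx : x ∈ ⋃₀ 𝒰 := h.2 ▸ mem_univ x
  exact hx

/-- Every nonempty open set meets a member of a maximal disjoint open family. -/
theorem IsMaximalDisjointOpenFamily.exists_inter_nonempty {𝒜 : Set (Set X)}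
    (h : IsMaximalDisjointOpenFamily X 𝒜) {G : Set X} (hG : IsOpen G) (hne : G.Nonempty) :
    ∃ A ∈ 𝒜, (G ∩ A).Nonempty := by
  by_contra hcon
  have hdis : ∀ A ∈ 𝒜, Disjoint G A := fun A hA =>
    disjoint_iff_inter_eq_empty.2 (not_nonempty_iff_eq_empty.1 fun hn => hcon ⟨A, hA, hn⟩)
  have hfam : IsDisjointOpenFamily X (insert G 𝒜) := by
    refine ⟨?_, ?_⟩
    · rintro A (rfl | hA)
      · exact ⟨hG, hne⟩
      · exact h.1.1 A hA
    · exact h.1.2.insert fun A hA _ => ⟨hdis A hA, (hdis A hA).symm⟩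
  have hmem : G ∈ 𝒜 := h.2 hfam (subset_insert G 𝒜) (mem_insert G 𝒜)
  exact hcon ⟨G, hmem, by simpa using hne⟩

/-- A disjoint open family is maximal as soon as every nonempty open set meets one of its
members. -/
theorem IsDisjointOpenFamily.isMaximal {𝒜 : Set (Set X)} (h : IsDisjointOpenFamily X 𝒜)
    (hmeet : ∀ G : Set X, IsOpen G → G.Nonempty → ∃ A ∈ 𝒜, (G ∩ A).Nonempty) :
    IsMaximalDisjointOpenFamily X 𝒜 := by
  refine ⟨h, fun ℬ hℬ hsub B hB => ?_⟩
  obtain ⟨A, hA, hne⟩ := hmeet B (hℬ.1 B hB).1 (hℬ.1 B hB).2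
  have hBA : B = A := by
    by_contra hne'
    exact (not_disjoint_iff_nonempty_inter.2 hne) (hℬ.2 hB (hsub hA) hne')
  exact hBA ▸ hA

/-- By maximality, the `n`-th member of the countable subfamily meets some `A n ∈ 𝒜 n`, so it lies
in the star of the union of the `A n`; this costs one extra star. -/
theorem IsSL.isSelectivelyStarCCC_succ [Nonempty X] {k : ℕ} (h : IsSL X k) :
    IsSelectivelyStarCCC X (k + 1) := by
  intro 𝒰 h𝒰 𝒜 h𝒜
  obtain ⟨𝒱, h𝒱, hcount, hstar⟩ := h 𝒰 h𝒰
  obtain ⟨U₀, hU₀, hx₀⟩ := h𝒰.exists_mem (Classical.arbitrary X)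
  -- Empty members are dropped since they meet nothing; `U₀` keeps the family nonempty, so that `ℕ`
  -- can enumerate it.
  obtain ⟨f, hf⟩ := ((hcount.mono (sdiff_subset (t := {∅}))).insert U₀).exists_eq_range
    (insert_nonempty U₀ _)
  have hfmem : ∀ n, f n ∈ 𝒰 ∧ (f n).Nonempty := by
    intro n
    have hn : f n ∈ insert U₀ (𝒱 \ {∅}) := hf ▸ mem_range_self n
    rcases hn with hn | hn
    · rw [hn]
      exact ⟨hU₀, _, hx₀⟩
    · exact ⟨h𝒱 hn.1, nonempty_iff_ne_empty.2 hn.2⟩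
  choose A hA hne using fun n =>
    (h𝒜 n).exists_inter_nonempty (h𝒰.1 _ (hfmem n).1) (hfmem n).2
  refine ⟨A, hA, ?_⟩
  rw [iterStar_succ_eq]
  refine univ_subset_iff.1 (hstar ▸ iterStar_mono k ?_ 𝒰)
  rintro x ⟨V, hV, hxV⟩
  have hVf : V ∈ range f := hf ▸ mem_insert_of_mem _ ⟨hV, fun h0 => by
    rw [mem_singleton_iff] at h0
    simp [h0] at hxV⟩
  obtain ⟨n, rfl⟩ := hVf
  exact mem_star_iff.2 ⟨f n, (hfmem n).1,
    (hne n).mono (inter_subset_inter_right _ (subset_iUnion A n)), hxV⟩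

/-- A space with a dense Lindelöf subset is star-Lindelöf. -/
theorem isSL_one_of_dense_isLindelof {Z : Set X} (hd : Dense Z) (hZ : IsLindelof Z) :
    IsSL X 1 := by
  intro 𝒰 h𝒰
  obtain ⟨𝒱, h𝒱, hcount, hcov⟩ := hZ.elim_countable_subcover_image (b := 𝒰) (c := id)
    (fun U hU => h𝒰.1 U hU) (by
      intro x _
      obtain ⟨U, hU, hx⟩ := h𝒰.exists_mem x
      exact mem_biUnion hU hx)
  refine ⟨𝒱, h𝒱, hcount, eq_univ_of_forall fun x => ?_⟩
  obtain ⟨U, hU, hx⟩ := h𝒰.exists_mem x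
  obtain ⟨z, hzU, hzZ⟩ := hd.inter_open_nonempty U (h𝒰.1 U hU) ⟨x, hx⟩
  refine mem_star_iff.2 ⟨U, hU, ⟨z, hzU, ?_⟩, hx⟩
  change z ∈ ⋃₀ 𝒱
  rw [sUnion_eq_biUnion]
  exact hcov hzZ

end General

/-! ### The Alexandroff duplicate -/

section Duplicate

/-- The underlying set of the Alexandroff duplicate of `K`: the points `(x, true)` are isolated,
and `(x, false)` has the neighbourhoods `U × Bool` without `(x, true)`. -/
def Duplicate (K : Type*) : Type _ := K × Bool

namespace Duplicate

variable {K : Type*}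

/-- The point of the duplicate over `x`, isolated when `b = true`. -/
def mk (x : K) (b : Bool) : Duplicate K := (x, b)

/-- The projection of the duplicate to the base space. -/
def base (p : Duplicate K) : K := p.1

/-- Whether a point of the duplicate is one of the isolated copies. -/
def isIso (p : Duplicate K) : Bool := p.2

/-- The neighbourhood filters of the Alexandroff duplicate. -/
def nbhd [TopologicalSpace K] (p : Duplicate K) : Filter (Duplicate K) :=
  bif p.isIso then pure p else comap base (𝓝 p.base) ⊓ 𝓟 {mk p.base true}ᶜ

variable [TopologicalSpace K]

instance : TopologicalSpace (Duplicate K) := TopologicalSpace.mkOfNhds nbhd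

theorem nhds_eq_nbhd [T1Space K] (p : Duplicate K) : 𝓝 p = nbhd p := by
  refine TopologicalSpace.nhds_mkOfNhds nbhd p ?_ ?_
  · rintro ⟨x, b⟩
    cases b
    · exact le_inf (by rw [← map_le_iff_le_comap]; exact pure_le_nhds x)
        (le_principal_iff.2 fun h => Bool.false_ne_true (congrArg isIso h))
    · exact le_rfl
  · rintro ⟨x, b⟩ s hs
    cases b
    · change s ∈ comap base (𝓝 x) ⊓ 𝓟 {mk x true}ᶜ at hs
      change ∀ᶠ y in comap base (𝓝 x) ⊓ 𝓟 {mk x true}ᶜ, s ∈ nbhd y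
      rw [mem_inf_principal] at hs
      rw [eventually_inf_principal]
      obtain ⟨t, ht, hts⟩ := mem_comap.1 hs
      filter_upwards [preimage_mem_comap (eventually_mem_nhds_iff.2 ht)] with y hy hyx
      rcases y with ⟨y, c⟩
      have hyt : t ∈ 𝓝 y := hy
      cases c
      · change s ∈ comap base (𝓝 y) ⊓ 𝓟 {mk y true}ᶜ
        rw [mem_inf_principal]
        rcases eq_or_ne y x with rfl | hne
        · filter_upwards [preimage_mem_comap hyt] with w hw hwy using hts hw hwy
        -- Away from the fibre over `x` the deleted point `mk x true` imposes no condition.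
        · filter_upwards [preimage_mem_comap hyt,
            preimage_mem_comap (isOpen_ne.mem_nhds hne)] with w hw hwx _
          exact hts hw fun h => hwx (congrArg base h)
      · exact hts (mem_of_mem_nhds hyt : y ∈ t) hyx
    · exact hs

variable [T1Space K]

theorem nhds_mk_true (x : K) : 𝓝 (mk x true) = pure (mk x true) := nhds_eq_nbhd _

theorem nhds_mk_false (x : K) :
    𝓝 (mk x false) = comap base (𝓝 x) ⊓ 𝓟 {mk x true}ᶜ := nhds_eq_nbhd _

theorem isOpen_singleton_mk_true (x : K) : IsOpen ({mk x true} : Set (Duplicate K)) := by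
  rw [isOpen_singleton_iff_nhds_eq_pure, nhds_mk_true]

theorem continuous_base : Continuous (base : Duplicate K → K) := by
  refine continuous_iff_continuousAt.2 ?_
  rintro ⟨x, b⟩
  cases b
  · change Tendsto base (𝓝 (mk x false)) (𝓝 x)
    rw [nhds_mk_false]
    exact tendsto_comap.mono_left inf_le_left
  · change Tendsto base (𝓝 (mk x true)) (𝓝 x)
    rw [nhds_mk_true]
    exact tendsto_pure_nhds base _

instance [FirstCountableTopology K] : FirstCountableTopology (Duplicate K) := by
  refine ⟨?_⟩
  rintro ⟨x, b⟩
  cases b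
  · change (𝓝 (mk x false)).IsCountablyGenerated
    rw [nhds_mk_false]
    infer_instance
  · change (𝓝 (mk x true)).IsCountablyGenerated
    rw [nhds_mk_true]
    infer_instance

/-- An ultrafilter whose projection converges to `x` either contains the isolated point over `x` or
converges to the other one. -/
instance [CompactSpace K] : CompactSpace (Duplicate K) := by
  refine ⟨isCompact_iff_ultrafilter_le_nhds.2 fun f _ => ?_⟩
  obtain ⟨x, -, hx⟩ := isCompact_univ.ultrafilter_le_nhds (f.map base) (by simp)
  by_cases h : {mk x true} ∈ f
  · refine ⟨mk x true, mem_univ _, ?_⟩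
    rw [nhds_mk_true, ← principal_singleton]
    exact le_principal_iff.2 h
  · refine ⟨mk x false, mem_univ _, ?_⟩
    rw [nhds_mk_false]
    exact le_inf (map_le_iff_le_comap.1 hx) (le_principal_iff.2 (Ultrafilter.compl_mem_iff_notMem.2 h))

theorem not_le_nhds_mk_both (f : Ultrafilter (Duplicate K)) (x : K)
    (h₀ : (f : Filter (Duplicate K)) ≤ 𝓝 (mk x false))
    (h₁ : (f : Filter (Duplicate K)) ≤ 𝓝 (mk x true)) : False := by
  have hin : {mk x true} ∈ f := h₁ ((isOpen_singleton_mk_true x).mem_nhds rfl)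
  have hout : {mk x true}ᶜ ∈ f := by
    refine h₀ ?_
    rw [nhds_mk_false]
    exact mem_inf_of_right (mem_principal_self _)
  exact Ultrafilter.compl_mem_iff_notMem.1 hout hin

end Duplicate

open Duplicate in
instance {K : Type*} [TopologicalSpace K] [T2Space K] : T2Space (Duplicate K) := by
  refine t2_iff_ultrafilter.2 ?_
  rintro ⟨x, b⟩ ⟨y, c⟩ f hx hy
  obtain rfl : x = y := by
    have h₁ : Tendsto base (f : Filter (Duplicate K)) (𝓝 x) :=
      (continuous_base.tendsto (mk x b)).mono_left hx
    have h₂ : Tendsto base (f : Filter (Duplicate K)) (𝓝 y) :=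
      (continuous_base.tendsto (mk y c)).mono_left hy
    exact tendsto_nhds_unique h₁ h₂
  cases b <;> cases c
  · rfl
  · exact (not_le_nhds_mk_both f x hx hy).elim
  · exact (not_le_nhds_mk_both f x hy hx).elim
  · rfl

open Duplicate in
theorem Duplicate.tendsto_mk_true {K : Type*} [TopologicalSpace K] [T1Space K] (x : K) :
    Tendsto (fun y => mk y true) (𝓝[≠] x) (𝓝 (mk x false)) := by
  rw [nhds_mk_false]
  refine tendsto_inf.2 ⟨tendsto_comap_iff.2 ?_, tendsto_principal.2 ?_⟩
  · exact nhdsWithin_le_nhds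
  · filter_upwards [self_mem_nhdsWithin] with y hy h
    exact hy (congrArg base h)

end Duplicate

/-! ### The first example -/

section DuplicateLine

open Duplicate

/-- The product of the Alexandroff duplicate of `K` with the real line, without the non-isolated
points of the duplicate at height `0`. -/
def DuplicateLine (K : Type*) [TopologicalSpace K] : Type _ :=
  {p : Duplicate K × ℝ // p.1.isIso = true ∨ p.2 ≠ 0}

namespace DuplicateLine

variable {K : Type*} [TopologicalSpace K]

instance : TopologicalSpace (DuplicateLine K) :=
  inferInstanceAs (TopologicalSpace {p : Duplicate K × ℝ // p.1.isIso = true ∨ p.2 ≠ 0})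

instance [T2Space K] : T2Space (DuplicateLine K) :=
  inferInstanceAs (T2Space {p : Duplicate K × ℝ // p.1.isIso = true ∨ p.2 ≠ 0})

instance [T1Space K] [FirstCountableTopology K] : FirstCountableTopology (DuplicateLine K) :=
  IsInducing.subtypeVal.firstCountableTopology

/-- The point at height `t` over the isolated copy of `x`. -/
def iso (x : K) (t : ℝ) : DuplicateLine K := ⟨(mk x true, t), Or.inl rfl⟩

theorem continuous_iso (x : K) : Continuous (iso x) :=
  Continuous.subtype_mk (by fun_prop) _

/-- The points at nonzero height. -/
def offZero (K : Type*) [TopologicalSpace K] : Set (DuplicateLine K) := {p | p.1.2 ≠ 0}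

/-- The vertical line over the isolated copy of `x`. -/
def line (x : K) : Set (DuplicateLine K) := {p | p.1.1 = mk x true}

theorem isOpen_offZero : IsOpen (offZero K) :=
  isOpen_ne.preimage (continuous_snd.comp continuous_subtype_val)

theorem isOpen_line [T1Space K] (x : K) : IsOpen (line x) :=
  (isOpen_singleton_mk_true x).preimage (continuous_fst.comp continuous_subtype_val)

theorem iso_mem_line (x : K) (t : ℝ) : iso x t ∈ line x := rfl

theorem eq_of_mem_line {x y : K} {p : DuplicateLine K} (hx : p ∈ line x) (hy : p ∈ line y) :
    x = y :=
  congrArg base ((show p.1.1 = mk x true from hx).symm.trans hy)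

theorem mem_offZero_or_eq_iso (p : DuplicateLine K) : p ∈ offZero K ∨ ∃ x, p = iso x 0 := by
  rcases p with ⟨⟨⟨x, b⟩, t⟩, hp⟩
  by_cases ht : t = 0
  · subst ht
    rcases hp with hp | hp
    · right
      refine ⟨x, ?_⟩
      obtain rfl : b = true := hp
      rfl
    · exact (hp rfl).elim
  · exact Or.inl ht

theorem dense_offZero : Dense (offZero K) := by
  intro p
  rcases mem_offZero_or_eq_iso p with hp | ⟨x, rfl⟩
  · exact subset_closure hp
  · refine mem_closure_of_tendsto
      (((continuous_iso x).tendsto 0).mono_left (nhdsWithin_le_nhds (s := {0}ᶜ))) ?_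
    filter_upwards [self_mem_nhdsWithin] with t ht using ht

theorem isLindelof_offZero [T1Space K] [CompactSpace K] : IsLindelof (offZero K) := by
  have : LocallyCompactSpace {t : ℝ // t ≠ 0} := (isOpen_ne (x := (0 : ℝ))).locallyCompactSpace
  let f : Duplicate K × {t : ℝ // t ≠ 0} → DuplicateLine K := fun q => ⟨(q.1, q.2.1), Or.inr q.2.2⟩
  have hf : Continuous f := Continuous.subtype_mk (by fun_prop) _
  have hr : range f = offZero K := by
    ext p
    refine ⟨?_, fun hp => ⟨(p.1.1, ⟨p.1.2, hp⟩), rfl⟩⟩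
    rintro ⟨q, rfl⟩
    exact q.2.2
  exact hr ▸ (isSigmaCompact_range hf).isLindelof

/-- Without isolated points in `K`, each non-isolated point of the duplicate is a limit of isolated
ones, at the same height. This gives maximality of the family of punctured lines. -/
theorem exists_line_inter_nonempty [T1Space K] [∀ x : K, (𝓝[≠] x).NeBot]
    {G : Set (DuplicateLine K)} (hG : IsOpen G) (hne : G.Nonempty) :
    ∃ x, (G ∩ (line x ∩ offZero K)).Nonempty := by
  obtain ⟨⟨⟨⟨x, b⟩, t⟩, hp⟩, hpG, ht⟩ := dense_offZero.inter_open_nonempty G hG hne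
  cases b
  · have hlim : Tendsto (fun y => iso y t) (𝓝[≠] x) (𝓝 ⟨(mk x false, t), hp⟩) :=
      tendsto_subtype_rng.2 ((tendsto_mk_true x).prodMk_nhds tendsto_const_nhds)
    obtain ⟨y, hy⟩ := (hlim.eventually (hG.mem_nhds hpG)).exists
    exact ⟨y, iso y t, hy, rfl, ht⟩
  · exact ⟨x, _, hpG, rfl, ht⟩

theorem isSL_one [T1Space K] [CompactSpace K] : IsSL (DuplicateLine K) 1 :=
  isSL_one_of_dense_isLindelof dense_offZero isLindelof_offZero

theorem not_isSelectivelyStarCCC_one [T1Space K] [Uncountable K] [∀ x : K, (𝓝[≠] x).NeBot] :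
    ¬ IsSelectivelyStarCCC (DuplicateLine K) 1 := by
  intro h
  have hcov : IsOpenCover (DuplicateLine K) (insert (offZero K) (range line)) := by
    refine ⟨?_, eq_univ_of_forall fun p => ?_⟩
    · rintro U (rfl | ⟨x, rfl⟩)
      · exact isOpen_offZero
      · exact isOpen_line x
    · rcases mem_offZero_or_eq_iso p with hp | ⟨x, rfl⟩
      · exact ⟨_, mem_insert _ _, hp⟩
      · exact ⟨_, mem_insert_of_mem _ ⟨x, rfl⟩, iso_mem_line x 0⟩
  have hmax : IsMaximalDisjointOpenFamily (DuplicateLine K)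
      (range fun x : K => line x ∩ offZero K) := by
    refine IsDisjointOpenFamily.isMaximal ⟨?_, ?_⟩ fun G hG hne => ?_
    · rintro _ ⟨x, rfl⟩
      exact ⟨(isOpen_line x).inter isOpen_offZero, iso x 1, rfl, one_ne_zero⟩
    · rintro _ ⟨x, rfl⟩ _ ⟨y, rfl⟩ hxy
      refine disjoint_left.2 fun p hpx hpy => hxy ?_
      rw [eq_of_mem_line hpx.1 hpy.1]
    · obtain ⟨x, hx⟩ := exists_line_inter_nonempty hG hne
      exact ⟨_, ⟨x, rfl⟩, hx⟩
  obtain ⟨A, hA, hstar⟩ := h _ hcov (fun _ => _) fun _ => hmax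
  choose x hx using hA
  obtain ⟨y, hy⟩ : ∃ y, y ∉ range x := by
    by_contra! hall
    exact not_countable_univ (α := K) ((countable_range x).mono fun y _ => hall y)
  have hmem : iso y 0 ∈ star (⋃ n, A n) (insert (offZero K) (range line)) := by
    rw [← iterStar_one, hstar]
    exact mem_univ _
  obtain ⟨U, hU, ⟨q, hqU, hqA⟩, hyU⟩ := mem_star_iff.1 hmem
  rcases hU with rfl | ⟨w, rfl⟩
  · exact hyU rfl
  · obtain ⟨n, hn⟩ := mem_iUnion.1 hqA
    rw [← hx n] at hn
    exact hy ⟨n, (eq_of_mem_line hn.1 hqU).trans (eq_of_mem_line hyU (iso_mem_line y 0))⟩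

end DuplicateLine

end DuplicateLine

/-! ### The label space of the hedgehog -/

section Fan

/-- The set `Option I` with the topology in which a set is open when it does not contain `none`
or is the whole space. -/
def Fan (I : Type*) : Type _ := Option I

namespace Fan

variable {I : Type*}

/-- The closed point of the fan. -/
def apex : Fan I := (none : Option I)

/-- The isolated points of the fan. -/
def tip (i : I) : Fan I := (some i : Option I)

theorem tip_injective : Function.Injective (tip : I → Fan I) := Option.some_injective I

theorem tip_ne_apex (i : I) : tip i ≠ apex := Option.some_ne_none i

theorem eq_apex_or_eq_tip (a : Fan I) : a = apex ∨ ∃ i, a = tip i := by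
  rcases a with _ | i
  · exact Or.inl rfl
  · exact Or.inr ⟨i, rfl⟩

instance : TopologicalSpace (Fan I) where
  IsOpen s := apex ∈ s → s = univ
  isOpen_univ _ := rfl
  isOpen_inter s t hs ht h := by rw [hs h.1, ht h.2, inter_univ]
  isOpen_sUnion S hS h := by
    obtain ⟨s, hs, ha⟩ := h
    exact univ_subset_iff.1 (hS s hs ha ▸ subset_sUnion_of_mem hs)

theorem isOpen_iff {s : Set (Fan I)} : IsOpen s ↔ (apex ∈ s → s = univ) := Iff.rfl

theorem isOpen_singleton_tip (i : I) : IsOpen ({tip i} : Set (Fan I)) :=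
  isOpen_iff.2 fun h => (tip_ne_apex i h.symm).elim

/-- This forces neighbourhoods of the common point of the hedgehog to be uniform over all spines,
which keeps it first countable there. -/
theorem nhds_apex : 𝓝 (apex : Fan I) = ⊤ := by
  refine top_unique fun s hs => ?_
  obtain ⟨t, hts, ht, ha⟩ := mem_nhds_iff.1 hs
  rw [isOpen_iff.1 ht ha] at hts
  exact mem_top.2 (univ_subset_iff.1 hts)

instance : FirstCountableTopology (Fan I) := by
  refine ⟨fun a => ?_⟩
  rcases eq_apex_or_eq_tip a with rfl | ⟨i, rfl⟩
  · rw [nhds_apex]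
    infer_instance
  · rw [isOpen_singleton_iff_nhds_eq_pure _ |>.1 (isOpen_singleton_tip i)]
    infer_instance

end Fan

end Fan

/-! ### The hedgehog and its covering properties -/

section Hedgehog

open Fan

/-- The hedgehog of copies of `O` indexed by `I`, glued together at `o`; a neighbourhood of the
common point contains the same neighbourhood of `o` in every copy. -/
def Hedgehog (O : Type*) (o : O) (I : Type*) : Type _ :=
  {p : O × Fan I // p.2 = apex ↔ p.1 = o}

namespace Hedgehog

variable {O : Type*} {o : O} {I : Type*}

/-- The coordinate of a point inside its copy of `O`. -/
def coord (p : Hedgehog O o I) : O := p.1.1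

/-- The spine on which a point lies, or the apex for the common point. -/
def label (p : Hedgehog O o I) : Fan I := p.1.2

theorem label_eq_apex_iff (p : Hedgehog O o I) : p.label = apex ↔ p.coord = o := p.2

theorem ext {p q : Hedgehog O o I} (h₁ : p.coord = q.coord) (h₂ : p.label = q.label) : p = q :=
  Subtype.ext (Prod.ext h₁ h₂)

open Classical in
/-- The inclusion of the copy of `O` with index `i`. -/
noncomputable def incl (i : I) (z : O) : Hedgehog O o I :=
  ⟨(z, if z = o then apex else tip i), by
    by_cases h : z = o <;> simp [h, tip_ne_apex]⟩

theorem label_incl {i : I} {z : O} (hz : z ≠ o) : (incl i z : Hedgehog O o I).label = tip i :=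
  if_neg hz

theorem exists_eq_incl [Nonempty I] (p : Hedgehog O o I) : ∃ i z, p = incl i z := by
  rcases eq_apex_or_eq_tip p.label with h | ⟨i, h⟩
  · refine ⟨Classical.arbitrary I, p.coord, ext rfl ?_⟩
    exact h.trans (if_pos ((label_eq_apex_iff p).1 h)).symm
  · refine ⟨i, p.coord, ext rfl ?_⟩
    rw [label_incl, h]
    exact fun hc => tip_ne_apex i (h.symm.trans ((label_eq_apex_iff p).2 hc))

/-- The copy of `O` with index `i`, without the common point. -/
def spine (o : O) (i : I) : Set (Hedgehog O o I) := {p | p.label = tip i}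

theorem eq_of_mem_spine {i j : I} {p : Hedgehog O o I} (hi : p ∈ spine o i)
    (hj : p ∈ spine o j) : i = j :=
  tip_injective ((show p.label = tip i from hi).symm.trans hj)

theorem incl_mem_spine {i : I} {z : O} (hz : z ≠ o) : incl i z ∈ spine o i := label_incl hz

theorem exists_mem_spine {p : Hedgehog O o I} (hp : p.coord ≠ o) : ∃ i, p ∈ spine o i :=
  (eq_apex_or_eq_tip p.label).resolve_left fun h => hp ((label_eq_apex_iff p).1 h)

/-- The cover of the hedgehog by the neighbourhood `B` of the common point and, on every spine,
the neighbourhood `N` of `z` and the complement of `z`. -/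
def spineCover (o : O) (I : Type*) (B N : Set O) (z : O) : Set (Set (Hedgehog O o I)) :=
  insert (coord ⁻¹' B)
    ((range fun i => spine o i ∩ coord ⁻¹' N) ∪ range fun i => spine o i ∩ coord ⁻¹' {z}ᶜ)

variable {B N : Set O} {z : O}

/-- The star of a set that misses a spine lies over `B` on that spine. -/
theorem coord_mem_of_mem_star {A : Set (Hedgehog O o I)} {i : I} (hA : Disjoint A (spine o i))
    {p : Hedgehog O o I} (hp : p ∈ star A (spineCover o I B N z)) (hpi : p ∈ spine o i) :
    p.coord ∈ B := by
  obtain ⟨U, hU, ⟨q, hqU, hqA⟩, hpU⟩ := mem_star_iff.1 hp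
  rcases hU with rfl | ⟨j, rfl⟩ | ⟨j, rfl⟩
  · exact hpU
  · exact (disjoint_left.1 hA hqA (eq_of_mem_spine hpU.1 hpi ▸ hqU.1)).elim
  · exact (disjoint_left.1 hA hqA (eq_of_mem_spine hpU.1 hpi ▸ hqU.1)).elim

/-- The only cover member containing `z` on spine `i` is the trace of `N`, and it misses the first
star, which lies over `B` there. -/
theorem incl_notMem_iterStar_two (hBN : Disjoint B N) (hzN : z ∈ N) (hzo : z ≠ o)
    {A : Set (Hedgehog O o I)} {i : I} (hA : Disjoint A (spine o i)) :
    incl i z ∉ iterStar 2 A (spineCover o I B N z) := by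
  intro hmem
  obtain ⟨U, hU, ⟨q, hqU, hqA⟩, hpU⟩ := mem_star_iff.1 hmem
  rcases hU with rfl | ⟨j, rfl⟩ | ⟨j, rfl⟩
  · exact disjoint_left.1 hBN hpU hzN
  · have hji : j = i := eq_of_mem_spine hpU.1 (incl_mem_spine hzo)
    subst hji
    exact disjoint_left.1 hBN (coord_mem_of_mem_star hA hqA hqU.1) hqU.2
  · exact hpU.2 rfl

variable [TopologicalSpace O]

instance : TopologicalSpace (Hedgehog O o I) :=
  inferInstanceAs (TopologicalSpace {p : O × Fan I // p.2 = apex ↔ p.1 = o})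

instance [FirstCountableTopology O] : FirstCountableTopology (Hedgehog O o I) :=
  IsInducing.subtypeVal.firstCountableTopology

theorem continuous_coord : Continuous (coord : Hedgehog O o I → O) :=
  continuous_fst.comp continuous_subtype_val

theorem continuous_label : Continuous (label : Hedgehog O o I → Fan I) :=
  continuous_snd.comp continuous_subtype_val

theorem isOpen_spine (i : I) : IsOpen (spine o i) :=
  (isOpen_singleton_tip i).preimage continuous_label

theorem continuous_incl [T1Space O] (i : I) : Continuous (incl i : O → Hedgehog O o I) := by
  classical
  refine Continuous.subtype_mk (continuous_id.prodMk ⟨fun s hs => ?_⟩) _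
  by_cases ha : apex ∈ s
  · rw [isOpen_iff.1 hs ha]
    exact isOpen_univ
  · by_cases hi : tip i ∈ s
    · convert isOpen_ne (x := o) using 1
      ext z
      by_cases hz : z = o <;> simp [hz, ha, hi]
    · convert isOpen_empty using 1
      ext z
      by_cases hz : z = o <;> simp [hz, ha, hi]

instance [T2Space O] : T2Space (Hedgehog O o I) := by
  refine ⟨fun p q hpq => ?_⟩
  by_cases h : p.coord = q.coord
  · by_cases hp : p.coord = o
    · refine (hpq (ext h ?_)).elim
      rw [(label_eq_apex_iff p).2 hp, (label_eq_apex_iff q).2 (h ▸ hp)]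
    · obtain ⟨i, hi⟩ := exists_mem_spine hp
      obtain ⟨j, hj⟩ := exists_mem_spine (h ▸ hp : q.coord ≠ o)
      refine ⟨spine o i, spine o j, isOpen_spine i, isOpen_spine j, hi, hj,
        disjoint_left.2 fun r hri hrj => hpq (ext h ?_)⟩
      rw [show p.label = tip i from hi, show q.label = tip j from hj, eq_of_mem_spine hri hrj]
  · obtain ⟨u, v, hu, hv, hpu, hqv, huv⟩ := t2_separation h
    exact ⟨coord ⁻¹' u, coord ⁻¹' v, hu.preimage continuous_coord, hv.preimage continuous_coord,
      hpu, hqv, huv.preimage coord⟩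

/-- If the closures of any two nonempty open sets of `O` meet, then the second star of any
member of an open cover containing the common point is the whole hedgehog. -/
theorem isSL_two [T1Space O] [Nonempty I]
    (hO : ∀ U V : Set O, IsOpen U → IsOpen V → U.Nonempty → V.Nonempty →
      (closure U ∩ closure V).Nonempty) : IsSL (Hedgehog O o I) 2 := by
  intro 𝒰 h𝒰
  obtain ⟨U, hU, hoU⟩ := h𝒰.exists_mem (incl (Classical.arbitrary I) o)
  refine ⟨{U}, singleton_subset_iff.2 hU, countable_singleton U, eq_univ_of_forall fun p => ?_⟩
  obtain ⟨i, z, rfl⟩ := exists_eq_incl p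
  obtain ⟨V, hV, hzV⟩ := h𝒰.exists_mem (incl i z)
  have hio : (incl i o : Hedgehog O o I) = incl (Classical.arbitrary I) o :=
    ext rfl (((label_eq_apex_iff _).2 rfl).trans ((label_eq_apex_iff _).2 rfl).symm)
  have hopen : ∀ W ∈ 𝒰, IsOpen (incl i ⁻¹' W : Set O) := fun W hW =>
    (h𝒰.1 W hW).preimage (continuous_incl i)
  obtain ⟨c, hcU, hcV⟩ := hO _ _ (hopen U hU) (hopen V hV) ⟨o, by rwa [mem_preimage, hio]⟩ ⟨z, hzV⟩
  -- A cover member around a common closure point meets both `U` and `V`, linking them in two stars.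
  obtain ⟨W, hW, hcW⟩ := h𝒰.exists_mem (incl i c)
  obtain ⟨a, haW, haU⟩ := mem_closure_iff.1 hcU _ (hopen W hW) hcW
  obtain ⟨b, hbW, hbV⟩ := mem_closure_iff.1 hcV _ (hopen W hW) hcW
  have haS : incl i a ∈ ⋃₀ {U} := mem_sUnion_of_mem haU rfl
  exact mem_star_iff.2
    ⟨V, hV, ⟨incl i b, hbV, mem_star_iff.2 ⟨W, hW, ⟨incl i a, haW, haS⟩, hbW⟩⟩, hzV⟩

theorem isOpenCover_spineCover [T1Space O] (hB : IsOpen B) (hN : IsOpen N) (hoB : o ∈ B)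
    (hzN : z ∈ N) : IsOpenCover (Hedgehog O o I) (spineCover o I B N z) := by
  refine ⟨?_, eq_univ_of_forall fun p => ?_⟩
  · rintro U (rfl | ⟨i, rfl⟩ | ⟨i, rfl⟩)
    · exact hB.preimage continuous_coord
    · exact (isOpen_spine i).inter (hN.preimage continuous_coord)
    · exact (isOpen_spine i).inter (isOpen_compl_singleton.preimage continuous_coord)
  · by_cases hp : p.coord = o
    · exact ⟨_, mem_insert _ _, by rwa [mem_preimage, hp]⟩
    · obtain ⟨i, hi⟩ := exists_mem_spine hp
      by_cases hz : p.coord = z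
      · exact ⟨_, Or.inr (Or.inl ⟨i, rfl⟩), hi, by rwa [mem_preimage, hz]⟩
      · exact ⟨_, Or.inr (Or.inr ⟨i, rfl⟩), hi, hz⟩

theorem not_isWeaklySSL_one [T2Space O] [Nontrivial O] [Uncountable I] :
    ¬ IsWeaklySSL (Hedgehog O o I) 1 := by
  intro h
  obtain ⟨z, hz⟩ := exists_ne o
  obtain ⟨B, N, hB, hN, hoB, hzN, hBN⟩ := t2_separation hz.symm
  obtain ⟨A, hA, hcl⟩ := h _ (isOpenCover_spineCover (I := I) hB hN hoB hzN)
  obtain ⟨i, hi⟩ : ∃ i : I, Disjoint A (spine o i) := by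
    by_contra! hall
    choose a ha has using fun i => not_disjoint_iff.1 (hall i)
    have hinj : Function.Injective a := fun i j hij =>
      eq_of_mem_spine (has i) (hij ▸ has j)
    have : Countable A := hA.to_subtype
    exact not_countable (α := I) (Function.Injective.countable (f := fun i => (⟨a i, ha i⟩ : A))
      fun i j hij => hinj (congrArg Subtype.val hij))
  have hmem : incl i z ∈ closure (iterStar 1 A (spineCover o I B N z)) := hcl ▸ mem_univ _
  obtain ⟨p, ⟨hpi, hpN⟩, hp⟩ := mem_closure_iff.1 hmem (spine o i ∩ coord ⁻¹' N)
    ((isOpen_spine i).inter (hN.preimage continuous_coord)) ⟨incl_mem_spine hz, hzN⟩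
  exact disjoint_left.1 hBN (coord_mem_of_mem_star hi hp hpi) hpN

theorem not_isSelectivelyStarCCC_two [T2Space O] [(𝓝[≠] o).NeBot] [Uncountable I] :
    ¬ IsSelectivelyStarCCC (Hedgehog O o I) 2 := by
  intro h
  obtain ⟨z, hz⟩ : ∃ z, z ≠ o :=
    Filter.nonempty_of_mem (self_mem_nhdsWithin : {o}ᶜ ∈ 𝓝[≠] o)
  obtain ⟨B, N, hB, hN, hoB, hzN, hBN⟩ := t2_separation hz.symm
  have hmax : IsMaximalDisjointOpenFamily (Hedgehog O o I) (range (spine o)) := by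
    refine IsDisjointOpenFamily.isMaximal ⟨?_, ?_⟩ fun G hG hne => ?_
    · rintro _ ⟨i, rfl⟩
      exact ⟨isOpen_spine i, _, incl_mem_spine hz⟩
    · rintro _ ⟨i, rfl⟩ _ ⟨j, rfl⟩ hij
      refine disjoint_left.2 fun p hpi hpj => hij ?_
      rw [eq_of_mem_spine hpi hpj]
    -- Only the common point lies on no spine, and it is a limit of points on spines because `o` is
    -- not isolated.
    · obtain ⟨p, hp⟩ := hne
      obtain ⟨i, w, rfl⟩ := exists_eq_incl p
      by_cases hw : w = o
      · subst hw
        have hnear : (incl i ⁻¹' G : Set O) ∈ 𝓝[≠] w :=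
          nhdsWithin_le_nhds ((hG.preimage (continuous_incl i)).mem_nhds hp)
        obtain ⟨v, hvG, hv⟩ := Filter.nonempty_of_mem (inter_mem hnear self_mem_nhdsWithin)
        exact ⟨_, ⟨i, rfl⟩, incl i v, hvG, incl_mem_spine hv⟩
      · exact ⟨_, ⟨i, rfl⟩, _, hp, incl_mem_spine hw⟩
  obtain ⟨A, hA, hstar⟩ := h _ (isOpenCover_spineCover (I := I) hB hN hoB hzN) (fun _ => _)
    fun _ => hmax
  choose x hx using hA
  obtain ⟨i, hi⟩ : ∃ i, i ∉ range x := by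
    by_contra! hall
    exact not_countable_univ (α := I) ((countable_range x).mono fun y _ => hall y)
  have hdis : Disjoint (⋃ n, A n) (spine o i) := by
    refine disjoint_iUnion_left.2 fun n => disjoint_left.2 fun p hp hpi => hi ⟨n, ?_⟩
    exact eq_of_mem_spine (hx n ▸ hp) hpi
  exact incl_notMem_iterStar_two hBN hzN hz hdis (hstar ▸ mem_univ _)

theorem not_dccc [T2Space O] [Nontrivial O] [Uncountable I] : ¬ DCCC (Hedgehog O o I) := by
  obtain ⟨z, hz⟩ := exists_ne o
  obtain ⟨B, N, hB, hN, hoB, hzN, hBN⟩ := t2_separation hz.symm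
  refine not_not.2 ⟨range fun i : I => spine o i ∩ coord ⁻¹' N, ?_, fun p => ?_, fun hc => ?_⟩
  · rintro _ ⟨i, rfl⟩
    exact (isOpen_spine i).inter (hN.preimage continuous_coord)
  · by_cases hp : p.coord = o
    -- Around the common point, the neighbourhood over `B` misses the whole family.
    · refine ⟨coord ⁻¹' B, (hB.preimage continuous_coord).mem_nhds (by rwa [mem_preimage, hp]), ?_⟩
      rintro _ ⟨⟨i, rfl⟩, q, hqN, hqB⟩
      exact (disjoint_left.1 hBN hqB hqN.2).elim
    · obtain ⟨i, hi⟩ := exists_mem_spine hp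
      refine ⟨spine o i, (isOpen_spine i).mem_nhds hi, ?_⟩
      rintro _ ⟨⟨j, rfl⟩, q, hqj, hqi⟩ _ ⟨⟨k, rfl⟩, r, hrk, hri⟩
      rw [eq_of_mem_spine hqj.1 hqi, eq_of_mem_spine hrk.1 hri]
  · have hinj : Function.Injective fun i : I => spine o i ∩ coord ⁻¹' N := by
      intro i j hij
      have hmem : incl i z ∈ spine o i ∩ coord ⁻¹' N := ⟨incl_mem_spine hz, hzN⟩
      exact eq_of_mem_spine hmem.1 ((show spine o i ∩ _ = spine o j ∩ _ from hij) ▸ hmem).1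
    have := hc.to_subtype
    exact not_countable (α := I)
      (Function.Injective.countable (f := rangeFactorization fun i : I => spine o i ∩ coord ⁻¹' N)
        fun i j hij => hinj (congrArg Subtype.val hij))

end Hedgehog

end Hedgehog

/-! ### The relatively prime integer topology -/

section RelativelyPrime

/-- The positive integers with the relatively prime integer topology, whose basic open sets are
the progressions `{k | k ≡ a [MOD b]}` with `a` and `b` coprime. -/
def CoprimeInt : Type := ℕ+

namespace CoprimeInt

/-- The value of a point as a natural number. -/
def val (a : CoprimeInt) : ℕ := PNat.val a

theorem val_injective : Function.Injective val := PNat.coe_injective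

theorem val_pos (a : CoprimeInt) : 0 < a.val := PNat.pos a

theorem exists_val_eq {n : ℕ} (hn : 0 < n) : ∃ a : CoprimeInt, a.val = n := ⟨⟨n, hn⟩, rfl⟩

/-- The residue class of `a` modulo `b`. -/
def progression (a : CoprimeInt) (b : ℕ) : Set CoprimeInt := {k | k.val ≡ a.val [MOD b]}

theorem self_mem_progression (a : CoprimeInt) (b : ℕ) : a ∈ progression a b := Nat.ModEq.refl _

theorem progression_mul_subset_left (a : CoprimeInt) (b c : ℕ) :
    progression a (b * c) ⊆ progression a b := fun _ hk => Nat.ModEq.of_mul_right c hk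

theorem progression_mul_subset_right (a : CoprimeInt) (b c : ℕ) :
    progression a (b * c) ⊆ progression a c := fun _ hk => Nat.ModEq.of_mul_left b hk

instance : TopologicalSpace CoprimeInt where
  IsOpen s := ∀ a ∈ s, ∃ b, 0 < b ∧ a.val.Coprime b ∧ progression a b ⊆ s
  isOpen_univ a _ := ⟨1, one_pos, Nat.coprime_one_right _, subset_univ _⟩
  isOpen_inter s t hs ht a ha := by
    obtain ⟨b, hb, hab, hbs⟩ := hs a ha.1
    obtain ⟨c, hc, hac, hct⟩ := ht a ha.2
    exact ⟨b * c, Nat.mul_pos hb hc, hab.mul_right hac, subset_inter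
      ((progression_mul_subset_left a b c).trans hbs)
      ((progression_mul_subset_right a b c).trans hct)⟩
  isOpen_sUnion S hS a ha := by
    obtain ⟨s, hs, has⟩ := ha
    obtain ⟨b, hb, hab, hbs⟩ := hS s hs a has
    exact ⟨b, hb, hab, hbs.trans (subset_sUnion_of_mem hs)⟩

theorem isOpen_iff {s : Set CoprimeInt} :
    IsOpen s ↔ ∀ a ∈ s, ∃ b, 0 < b ∧ a.val.Coprime b ∧ progression a b ⊆ s := Iff.rfl

theorem isOpen_progression {a : CoprimeInt} {b : ℕ} (hb : 0 < b) (hab : a.val.Coprime b) :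
    IsOpen (progression a b) := by
  refine isOpen_iff.2 fun k hk => ⟨b, hb, ?_, fun l hl => Nat.ModEq.trans hl hk⟩
  exact (Nat.ModEq.gcd_eq hk).trans hab

theorem nhds_hasBasis (a : CoprimeInt) :
    (𝓝 a).HasBasis (fun b => 0 < b ∧ a.val.Coprime b) (progression a) := by
  refine ⟨fun s => ⟨fun hs => ?_, ?_⟩⟩
  · obtain ⟨t, hts, ht, hat⟩ := mem_nhds_iff.1 hs
    obtain ⟨b, hb, hab, hbt⟩ := isOpen_iff.1 ht a hat
    exact ⟨b, ⟨hb, hab⟩, hbt.trans hts⟩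
  · rintro ⟨b, ⟨hb, hab⟩, hbs⟩
    exact mem_of_superset ((isOpen_progression hb hab).mem_nhds (self_mem_progression a b)) hbs

instance : FirstCountableTopology CoprimeInt :=
  ⟨fun a => (nhds_hasBasis a).isCountablyGenerated⟩

instance : T2Space CoprimeInt := by
  refine ⟨fun a c hac => ?_⟩
  -- A prime above both values is coprime to both and keeps their residues distinct.
  obtain ⟨p, hle, hp⟩ := Nat.exists_infinite_primes (a.val + c.val + 1)
  have hcop : ∀ k : CoprimeInt, k.val < p → k.val.Coprime p := fun k hk =>
    (Nat.coprime_of_lt_prime k.val_pos.ne' hk hp).symm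
  have ha : a.val < p := by omega
  have hc : c.val < p := by omega
  refine ⟨_, _, isOpen_progression hp.pos (hcop a ha), isOpen_progression hp.pos (hcop c hc),
    self_mem_progression a p, self_mem_progression c p, disjoint_left.2 fun k hka hkc => hac ?_⟩
  exact val_injective (Nat.ModEq.eq_of_lt_of_lt (Nat.ModEq.trans (Nat.ModEq.symm hka) hkc) ha hc)

instance (a : CoprimeInt) : (𝓝[≠] a).NeBot := by
  refine (nhdsWithin_hasBasis (nhds_hasBasis a) _).neBot_iff.2 ?_
  rintro b ⟨hb, -⟩
  obtain ⟨k, hk⟩ := exists_val_eq (Nat.add_pos_left a.val_pos b)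
  refine ⟨k, ?_, ?_⟩
  · change k.val ≡ a.val [MOD b]
    simp [hk, Nat.ModEq]
  · rintro rfl
    omega

/-- Two residue classes with coprime moduli meet. -/
theorem progression_inter_nonempty (a c : CoprimeInt) {b d : ℕ} (hb : 0 < b) (hd : 0 < d)
    (hbd : b.Coprime d) : (progression a b ∩ progression c d).Nonempty := by
  obtain ⟨n, hna, hnc⟩ := Nat.chineseRemainder hbd a.val c.val
  -- The Chinese remainder solution `n` may be `0`; adding `b * d` makes it positive.
  obtain ⟨k, hk⟩ := exists_val_eq (Nat.add_pos_right n (Nat.mul_pos hb hd))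
  refine ⟨k, ?_, ?_⟩
  · change k.val ≡ a.val [MOD b]
    rw [hk]
    exact Nat.ModEq.trans (by simp [Nat.ModEq]) hna
  · change k.val ≡ c.val [MOD d]
    rw [hk]
    exact Nat.ModEq.trans (by simp [Nat.ModEq]) hnc

/-- The multiples of the modulus lie in the closure of a residue class. -/
theorem mem_closure_progression {a c : CoprimeInt} {b : ℕ} (hb : 0 < b) (hbc : b ∣ c.val) :
    c ∈ closure (progression a b) := by
  refine (mem_closure_iff_nhds_basis' (nhds_hasBasis c)).2 ?_
  rintro d ⟨hd, hcd⟩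
  rw [inter_comm]
  exact progression_inter_nonempty a c hb hd (hcd.coprime_dvd_left hbc)

/-- The product of the moduli of progressions inside `U` and `V` is a multiple of each, hence in
both closures. -/
theorem closure_inter_closure_nonempty (U V : Set CoprimeInt) (hU : IsOpen U) (hV : IsOpen V)
    (hneU : U.Nonempty) (hneV : V.Nonempty) : (closure U ∩ closure V).Nonempty := by
  obtain ⟨a, ha⟩ := hneU
  obtain ⟨c, hc⟩ := hneV
  obtain ⟨b, hb, -, hbU⟩ := isOpen_iff.1 hU a ha
  obtain ⟨d, hd, -, hdV⟩ := isOpen_iff.1 hV c hc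
  obtain ⟨k, hk⟩ := exists_val_eq (Nat.mul_pos hb hd)
  exact ⟨k, closure_mono hbU (mem_closure_progression hb (hk ▸ dvd_mul_right b d)),
    closure_mono hdV (mem_closure_progression hd (hk ▸ dvd_mul_left d b))⟩

instance : Nontrivial CoprimeInt := inferInstanceAs (Nontrivial ℕ+)

instance : Inhabited CoprimeInt := inferInstanceAs (Inhabited ℕ+)

end CoprimeInt

end RelativelyPrime

theorem uncountable_unitInterval : Uncountable unitInterval :=
  not_countable_iff.1 fun _ => not_le.2 zero_lt_one 
    (Cardinal.Real.Icc_countable_iff.1 (to_countable _))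

end StarCov

open StarCov in
theorem mainTheorem2 :
    (∃ (X : Type) (_ : TopologicalSpace X),
      Nonempty X ∧ T2Space X ∧ FirstCountableTopology X ∧
      StarCov.IsSL X 1 ∧ StarCov.IsSelectivelyStarCCC X 2 ∧
      ¬ StarCov.IsSelectivelyStarCCC X 1) ∧
    (∃ (Y : Type) (_ : TopologicalSpace Y),
      Nonempty Y ∧ T2Space Y ∧ FirstCountableTopology Y ∧
      StarCov.IsSL Y 2 ∧ StarCov.IsSelectivelyStarCCC Y 3 ∧
      ¬ StarCov.IsSelectivelyStarCCC Y 2 ∧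
      ¬ StarCov.IsWeaklySSL Y 1 ∧
      ¬ StarCov.DCCC Y) := by
  have := uncountable_unitInterval
  refine ⟨⟨DuplicateLine unitInterval, inferInstance, ⟨DuplicateLine.iso 0 0⟩, inferInstance,
    inferInstance, DuplicateLine.isSL_one, ?_, DuplicateLine.not_isSelectivelyStarCCC_one⟩,
    ⟨Hedgehog CoprimeInt default ℝ, inferInstance, ⟨Hedgehog.incl 0 default⟩, inferInstance,
      inferInstance, Hedgehog.isSL_two CoprimeInt.closure_inter_closure_nonempty, ?_,
      Hedgehog.not_isSelectivelyStarCCC_two, Hedgehog.not_isWeaklySSL_one, Hedgehog.not_dccc⟩⟩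
  · have : Nonempty (DuplicateLine unitInterval) := ⟨DuplicateLine.iso 0 0⟩
    exact DuplicateLine.isSL_one.isSelectivelyStarCCC_succ
  · have : Nonempty (Hedgehog CoprimeInt default ℝ) := ⟨Hedgehog.incl 0 default⟩
    exact (Hedgehog.isSL_two
      CoprimeInt.closure_inter_closure_nonempty).isSelectivelyStarCCC_succ
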